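/- For $n\ge 0$, let $G\sim G(n,1/2)$ be the random graph on $n$ labelled vertices in which each of the $\binom n2$ possible edges is present independently with probability $1/2$, and consider the following greedy heuristic (of Grimmett and McDiarmid): scan the vertices of $G$ in a uniformly random order, independent of $G$, starting with the empty set and adding each scanned vertex that is not adjacent to any of the vertices added so far. Let $\mathbf{k}$ be the size of the stable set obtained when all vertices have been scanned. Let $\mathrm{Hypo}=\sum_{i=1}^\infty E_i$, where $E_1,E_2,\dots$ are independent exponential random variables and $E_i$ has rate $2^i$ (mean $2^{-i}$). For integers $k\ge0$ put $$p_k=p_k(n)=\Pr[\mathbf{k}=k],\qquad q_k=q_k(n)=\Pr\left[\frac{n}{2^{k+1}}\le \mathrm{Hypo}<\frac{n}{2^k}\right].$$ Then the series $\sum_{k=0}^\infty|p_k-q_k|$ converges for every $n$, and as $n\to\infty$ $$\sum_{k=0}^\infty|p_k-q_k|=o(1);\qquad\text{more precisely,}\qquad \sum_{k=0}^\infty|p_k-q_k|=O\left(\frac{\sqrt{\log n}}{n^{1/3}}\right).$$ -/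

import Mathlib

open MeasureTheory ProbabilityTheory Filter Topology Asymptotics

/-- The Grimmett–McDiarmid greedy heuristic: scan the vertices in the order of the list, adding to
the set any vertex that is adjacent to none of the vertices added so far. -/
noncomputable def greedyStableSet {V : Type*} [DecidableEq V] (G : SimpleGraph V) (l : List V) :
    Finset V :=
  open Classical in
  l.foldl (fun S v => if ∀ u ∈ S, ¬ G.Adj u v then insert v S else S) ∅

/-- Size of the stable set found when the vertices `0, …, n - 1` are scanned in the order
`σ 0, σ 1, …, σ (n - 1)`. -/
noncomputable def greedySize (n : ℕ) (G : SimpleGraph (Fin n)) (σ : Equiv.Perm (Fin n)) : ℕ :=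
  (greedyStableSet G ((List.finRange n).map σ)).card

/-- All sets of scanning orders are events. -/
instance instMeasurableSpacePermFin (n : ℕ) : MeasurableSpace (Equiv.Perm (Fin n)) := ⊤

/-- A random graph `G(n, 1/2)` together with an independent, uniformly random scanning order. -/
noncomputable def graphOrderMeasure (n : ℕ) :
    Measure (SimpleGraph (Fin n) × Equiv.Perm (Fin n)) :=
  (SimpleGraph.binomialRandom (Fin n) ⟨1 / 2, by norm_num, by norm_num⟩).prod
    (uniformOn Set.univ)

/-- `p_k`, the probability that the heuristic finds a stable set of size `k`. -/
noncomputable def pGreedy (n k : ℕ) : ℝ :=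
  (graphOrderMeasure n).real {x | greedySize n x.1 x.2 = k}

/-- Law of a sequence of independent exponential random variables with rates `2, 4, 8, …`; the
coordinate with index `i : ℕ` has rate `2 ^ (i + 1)`. -/
noncomputable def expSeqMeasure : Measure (ℕ → ℝ) :=
  Measure.infinitePi fun i : ℕ => expMeasure (2 ^ (i + 1))

/-- The random variable `∑_{i ≥ 1} Exp(2 ^ i)`, on the probability space `expSeqMeasure`. -/
noncomputable def hypo (x : ℕ → ℝ) : ℝ := ∑' i, x i

/-- `q_k`, the probability that `n / 2 ^ (k + 1) ≤ hypo < n / 2 ^ k`. -/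
noncomputable def qHypo (n k : ℕ) : ℝ :=
  expSeqMeasure.real {x | (n : ℝ) / 2 ^ (k + 1) ≤ hypo x ∧ hypo x < (n : ℝ) / 2 ^ k}

/-! The factors are probability measures, and the series converges almost surely to a random
variable. -/

instance instProbExpTwoPow (i : ℕ) : IsProbabilityMeasure (expMeasure ((2 : ℝ) ^ (i + 1))) :=
  isProbabilityMeasure_expMeasure (by positivity)

instance instProbExpSeq : IsProbabilityMeasure expSeqMeasure := by
  unfold expSeqMeasure; infer_instance

theorem lintegral_expMeasure_le {r : ℝ} (hr : 0 < r) :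
    ∫⁻ x, ENNReal.ofReal x ∂(expMeasure r) ≤ ENNReal.ofReal (1 / r) := by
  have hm : Measurable (gammaPDF 1 r) := (measurable_gammaPDFReal 1 r).ennreal_ofReal
  rw [expMeasure, gammaMeasure, lintegral_withDensity_eq_lintegral_mul _ hm (by fun_prop)]
  calc ∫⁻ x, (gammaPDF 1 r * fun x => ENNReal.ofReal x) x
      ≤ ∫⁻ x, ENNReal.ofReal (1 / r) * gammaPDF 2 r x := by
        refine lintegral_mono fun x => ?_
        rcases lt_or_ge x 0 with hx | hx
        · simp [gammaPDF_of_neg hx]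
        · rw [Pi.mul_apply, gammaPDF_of_nonneg hx, gammaPDF_of_nonneg hx,
            ← ENNReal.ofReal_mul' hx, ← ENNReal.ofReal_mul (by positivity)]
          refine ENNReal.ofReal_le_ofReal (le_of_eq ?_)
          have h2 : Real.Gamma 2 = 1 := by simp
          norm_num [h2]
          field_simp
    _ = ENNReal.ofReal (1 / r) := by
        have hm2 : Measurable (gammaPDF 2 r) := (measurable_gammaPDFReal 2 r).ennreal_ofReal
        rw [lintegral_const_mul _ hm2,
          lintegral_gammaPDF_eq_one two_pos hr, mul_one]

theorem ae_nonneg_expMeasure {r : ℝ} : ∀ᵐ x ∂(expMeasure r), 0 ≤ x := by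
  have hs : {x : ℝ | ¬ 0 ≤ x} = Set.Iio 0 := by ext; simp
  rw [ae_iff, hs, expMeasure, gammaMeasure, withDensity_apply _ measurableSet_Iio]
  exact lintegral_gammaPDF_of_nonpos le_rfl

theorem ae_summable_expSeqMeasure : ∀ᵐ x ∂expSeqMeasure, Summable x := by
  have hmp : ∀ i : ℕ, MeasurePreserving (fun x : ℕ → ℝ => x i) expSeqMeasure
      (expMeasure (2 ^ (i + 1))) := fun i =>
    measurePreserving_eval_infinitePi (fun i : ℕ => expMeasure ((2 : ℝ) ^ (i + 1))) i
  have h0 : ∀ᵐ x ∂expSeqMeasure, ∀ i, 0 ≤ x i :=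
    ae_all_iff.2 fun i => (hmp i).quasiMeasurePreserving.ae ae_nonneg_expMeasure
  have hfin : ∫⁻ x, ∑' i, ENNReal.ofReal (x i) ∂expSeqMeasure ≠ ⊤ := by
    rw [lintegral_tsum fun i => (measurable_pi_apply i).ennreal_ofReal.aemeasurable]
    have hs : Summable fun i : ℕ => 1 / (2 : ℝ) ^ (i + 1) := by
      simpa [pow_succ, mul_comm] using summable_geometric_two.mul_left (1 / 2 : ℝ)
    refine ne_top_of_le_ne_top hs.tsum_ofReal_ne_top (ENNReal.tsum_le_tsum fun i => ?_)
    rw [(hmp i).lintegral_comp (f := fun y => ENNReal.ofReal y) (by fun_prop)]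
    exact lintegral_expMeasure_le (by positivity)
  filter_upwards [h0, ae_lt_top (by fun_prop) hfin] with x hx hlt
  have := ENNReal.summable_toReal hlt.ne
  simpa [ENNReal.toReal_ofReal (hx _)] using this

theorem aemeasurable_hypo : AEMeasurable hypo expSeqMeasure := by
  refine aemeasurable_of_tendsto_metrizable_ae (f := fun n x => ∑ i ∈ Finset.range n, x i)
    atTop (fun n => by fun_prop) ?_
  filter_upwards [ae_summable_expSeqMeasure] with x hx
  exact hx.hasSum.tendsto_sum_nat

/-! While the set has size `k`, each newly scanned vertex joins it with probability `2^(-k)`. So the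
time to reach size `k` is a sum of independent geometric waiting times with success probabilities
`1, 1/2, …, 2^(-(k-1))`; divided by `2^k`, these look like exponentials of rates `2^k, …, 4, 2`,
whence the law of `hypo`.

The coupling is replaced by an induction. `greedyTail` satisfies the recurrence
`greedyTail_succ_succ`. Self-similarity (halving `Exp(r)` gives `Exp(2r)`) and memorylessness give
the distribution functions of the partial sums nearly the same recurrence, as two inequalities.
Induction on `n` then sandwiches the tail: `hypoPartialCDF_le_greedyTail` has a time shift `k`, and
`greedyTail_le_hypoPartialCDF` discards the first `j` waiting times and dilates time by `1/(1 -
2^(-j))`. The 2-Lipschitz bound and the geometric convergence of the partial sums turn this into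
bounds on `tailDiff`.

With `n` of order `A^6`, take `j` with `2^j = A^3`: the errors are `O(A^(-2))` at `2^k = A^5` and
decay geometrically for larger `k`. For smaller `k` both tails are near `1`. The total is
`O(n^(-1/3))`, without the logarithmic factor. -/

section Greedy

variable {V W : Type*} [DecidableEq V] [DecidableEq W]

/-! ### The greedy set under relabelling and under adding a last vertex. -/

theorem greedyStableSet_append_singleton (G : SimpleGraph V) (l : List V) (v : V)
    [Decidable (∀ u ∈ greedyStableSet G l, ¬ G.Adj u v)] :
    greedyStableSet G (l ++ [v]) =
      if ∀ u ∈ greedyStableSet G l, ¬ G.Adj u v then insert v (greedyStableSet G l)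
      else greedyStableSet G l := by
  rw [greedyStableSet, List.foldl_append]
  simp only [List.foldl_cons, List.foldl_nil]
  rw [← greedyStableSet]
  congr

/-- The heuristic only queries adjacency between scanned vertices. This serves both to absorb the
scanning order into the graph and to restrict to the first `n` vertices. -/
theorem greedyStableSet_map (f : V ↪ W) (G : SimpleGraph W) (l : List V) :
    greedyStableSet G (l.map f) = (greedyStableSet (G.comap f) l).map f := by
  classical
  induction l using List.reverseRecOn with
  | nil => simp [greedyStableSet]
  | append_singleton l v ih =>
    rw [List.map_append, List.map_singleton, greedyStableSet_append_singleton,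
      greedyStableSet_append_singleton, ih]
    simp only [Finset.mem_map, forall_exists_index, and_imp, forall_apply_eq_imp_iff₂,
      SimpleGraph.comap_adj]
    split_ifs <;> simp

end Greedy

theorem greedySize_comap (n : ℕ) (G : SimpleGraph (Fin n)) (σ : Equiv.Perm (Fin n)) :
    greedySize n G σ = greedySize n (G.comap σ) 1 := by
  have h := greedyStableSet_map σ.toEmbedding G (List.finRange n)
  simp only [Equiv.coe_toEmbedding] at h
  simp [greedySize, h]

theorem greedySize_le (n : ℕ) (G : SimpleGraph (Fin n)) (σ : Equiv.Perm (Fin n)) :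
    greedySize n G σ ≤ n := by
  simpa [greedySize] using (greedyStableSet G ((List.finRange n).map σ)).card_le_univ

/-- A graph on `n + 1` vertices is a graph on the first `n` vertices together with the
neighbourhood of the last one. -/
noncomputable def simpleGraphFinSuccEquiv (n : ℕ) :
    SimpleGraph (Fin (n + 1)) ≃ SimpleGraph (Fin n) × Finset (Fin n) := by
  classical
  exact
  { toFun := fun G => (G.comap Fin.castSucc,
      Finset.univ.filter fun i => G.Adj i.castSucc (Fin.last n))
    invFun := fun x =>
      { Adj := Fin.lastCases (Fin.lastCases False fun j => j ∈ x.2)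
          fun i => Fin.lastCases (i ∈ x.2) fun j => x.1.Adj i j
        symm := ⟨fun a b => by
          refine Fin.lastCases ?_ (fun i => ?_) a <;> refine Fin.lastCases ?_ (fun j => ?_) b <;>
            simp [SimpleGraph.adj_comm]⟩
        loopless := ⟨fun a => by
          refine Fin.lastCases ?_ (fun i => ?_) a <;> simp⟩ }
    left_inv := fun G => by
      ext a b
      refine Fin.lastCases ?_ (fun i => ?_) a <;> refine Fin.lastCases ?_ (fun j => ?_) b <;>
            simp [SimpleGraph.adj_comm]
    right_inv := fun x => by
      refine Prod.ext ?_ ?_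
      · ext a b
        simp
      · ext a
        simp }

open Classical in
theorem greedySize_succ (n : ℕ) (G : SimpleGraph (Fin (n + 1))) :
    greedySize (n + 1) G 1 = greedySize n (simpleGraphFinSuccEquiv n G).1 1 +
      if Disjoint (simpleGraphFinSuccEquiv n G).2
        (greedyStableSet (simpleGraphFinSuccEquiv n G).1 (List.finRange n)) then 1 else 0 := by
  have h := greedyStableSet_map Fin.castSuccEmb G (List.finRange n)
  simp only [Fin.coe_castSuccEmb] at h
  have e1 : (simpleGraphFinSuccEquiv n G).1 = G.comap Fin.castSucc := rfl
  have e2 : (simpleGraphFinSuccEquiv n G).2 =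
    Finset.univ.filter fun i => G.Adj i.castSucc (Fin.last n) := rfl
  simp only [greedySize, Equiv.Perm.coe_one, List.map_id, e1, e2]
  rw [List.finRange_succ_last, greedyStableSet_append_singleton, h]
  simp only [Finset.mem_map, Fin.coe_castSuccEmb, forall_exists_index, and_imp,
    forall_apply_eq_imp_iff₂, Finset.disjoint_left, Finset.mem_filter, Finset.mem_univ, true_and]
  have hc : (∀ a ∈ greedyStableSet (G.comap Fin.castSucc) (List.finRange n),
      ¬ G.Adj a.castSucc (Fin.last n)) ↔ ∀ ⦃a⦄, G.Adj a.castSucc (Fin.last n) →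
      a ∉ greedyStableSet (G.comap Fin.castSucc) (List.finRange n) :=
    ⟨fun h a h1 h2 => h a h2 h1, fun h a h1 h2 => h h2 h1⟩
  by_cases hd : ∀ a ∈ greedyStableSet (G.comap Fin.castSucc) (List.finRange n),
      ¬ G.Adj a.castSucc (Fin.last n)
  · rw [if_pos hd, if_pos (hc.1 hd), Finset.card_insert_of_notMem, Finset.card_map]
    simp
  · rw [if_neg hd, if_neg (fun h => hd (hc.2 h)), Finset.card_map, add_zero]

/-! ### The size distribution by counting graphs, and its recurrence. -/

instance measurableSingletonClass_simpleGraph (n : ℕ) :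
    MeasurableSingletonClass (SimpleGraph (Fin n)) := by
  refine ⟨fun G => ?_⟩
  rw [← SimpleGraph.measurableEmbedding_edgeSet.measurableSet_image, Set.image_singleton]
  exact MeasurableSet.singleton _

instance measurableSingletonClass_permFin (n : ℕ) :
    MeasurableSingletonClass (Equiv.Perm (Fin n)) := ⟨fun _ => trivial⟩

/-- The probability that the heuristic finds a stable set of size at least `k`. -/
noncomputable def greedyTail (n k : ℕ) : ℝ :=
  (graphOrderMeasure n).real {x | k ≤ greedySize n x.1 x.2}

instance isProbabilityMeasure_uniformOn_perm (n : ℕ) :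
    IsProbabilityMeasure (uniformOn (Set.univ : Set (Equiv.Perm (Fin n)))) :=
  isProbabilityMeasure_uniformOn Set.finite_univ Set.univ_nonempty

instance isProbabilityMeasure_graphOrderMeasure (n : ℕ) :
    IsProbabilityMeasure (graphOrderMeasure n) := by
  unfold graphOrderMeasure
  infer_instance

theorem pGreedy_eq_sub (n k : ℕ) : pGreedy n k = greedyTail n k - greedyTail n (k + 1) := by
  rw [pGreedy, greedyTail, greedyTail, ← measureReal_sdiff]
  · congr 1
    ext x
    simp
    omega
  · intro x hx
    simp at hx ⊢
    omega
  · exact Set.Finite.measurableSet (Set.toFinite _)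

/-- Edges and non-edges both weigh `1/2`, so all graphs are equally likely. -/
theorem binomialRandom_half_real (n : ℕ) (A : Finset (SimpleGraph (Fin n))) :
    (SimpleGraph.binomialRandom (Fin n) ⟨1 / 2, by norm_num, by norm_num⟩).real A =
      (A.card : ℝ) / Nat.card (SimpleGraph (Fin n)) := by
  classical
  set μ := SimpleGraph.binomialRandom (Fin n) ⟨1 / 2, by norm_num, by norm_num⟩ with hμ
  obtain ⟨c, hc⟩ : ∃ c : ℝ, ∀ G, μ.real {G} = c := by
    refine ⟨(1 / 2) ^ n.choose 2, fun G => ?_⟩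
    have hle : G.edgeSet.ncard ≤ n.choose 2 := by
      have := G.card_edgeFinset_le_card_choose_two
      rw [Set.ncard_eq_toFinset_card']
      simpa [SimpleGraph.edgeFinset] using this
    rw [measureReal_def, SimpleGraph.binomialRandom_singleton]
    simp only [ENNReal.toReal_mul, ENNReal.toReal_pow, Nat.card_eq_fintype_card, Fintype.card_fin,
      ENNReal.coe_toReal, unitInterval.coe_toNNReal, unitInterval.coe_symm_eq]
    rw [show (1 - 1 / 2 : ℝ) = 1 / 2 by norm_num, ← pow_add]
    congr 1
    omega
  have hA : ∀ A : Finset (SimpleGraph (Fin n)), μ.real A = A.card * c := fun A => by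
    rw [← sum_measureReal_singleton]
    simp [hc]
  have h1 := hA Finset.univ
  rw [Finset.coe_univ, probReal_univ, Finset.card_univ, ← Nat.card_eq_fintype_card] at h1
  have h0 : (Nat.card (SimpleGraph (Fin n)) : ℝ) ≠ 0 := by
    intro h
    rw [h] at h1
    simp at h1
  rw [hA, eq_div_iff h0, mul_assoc, mul_comm c, ← h1, mul_one]

-- Relabelling by a fixed order permutes the equally likely graphs, so every order gives the same
-- distribution as the identity.
open Classical in
theorem greedyTail_eq_div (n k : ℕ) : greedyTail n k =
    ((Finset.univ.filter fun G : SimpleGraph (Fin n) => k ≤ greedySize n G 1).card : ℝ) /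
      Nat.card (SimpleGraph (Fin n)) := by
  rw [← binomialRandom_half_real]
  rw [greedyTail, measureReal_def, graphOrderMeasure,
    Measure.prod_apply_symm (Set.Finite.measurableSet (Set.toFinite _))]
  rw [measureReal_def]
  congr 1
  have h : ∀ σ : Equiv.Perm (Fin n),
      SimpleGraph.binomialRandom (Fin n) ⟨1 / 2, by norm_num, by norm_num⟩
      ((fun G => (G, σ)) ⁻¹' {x | k ≤ greedySize n x.1 x.2}) =
      SimpleGraph.binomialRandom (Fin n) ⟨1 / 2, by norm_num, by norm_num⟩
        ↑(Finset.univ.filter fun G : SimpleGraph (Fin n) => k ≤ greedySize n G 1) := fun σ => by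
    rw [← ENNReal.toReal_eq_toReal_iff' (measure_ne_top _ _) (measure_ne_top _ _),
      ← measureReal_def, ← measureReal_def]
    have : (fun G => (G, σ)) ⁻¹' {x | k ≤ greedySize n x.1 x.2} =
      ↑(Finset.univ.filter fun G : SimpleGraph (Fin n) => k ≤ greedySize n G σ) := by
      ext; simp
    rw [this, binomialRandom_half_real, binomialRandom_half_real]
    congr 2
    refine Finset.card_bij (fun G _ => G.comap σ) ?_ ?_ ?_
    · intro G hG
      simpa [← greedySize_comap] using hG
    · intro G _ G' _ h
      simpa [SimpleGraph.comap_comap] using congrArg (SimpleGraph.comap σ.symm) h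
    · intro G hG
      refine ⟨G.comap σ.symm, ?_, ?_⟩
      · rw [Finset.mem_filter, greedySize_comap]
        simpa [SimpleGraph.comap_comap] using hG
      · simp [SimpleGraph.comap_comap]
  simp only [h, lintegral_const, measure_univ, mul_one]

/-- Condition on the graph on the first `n` vertices: the last neighbourhood is a uniform subset,
disjoint from a set of size `k` with probability `2^(-k)`. Only the case of current size exactly `k`
depends on it. -/
theorem greedyTail_succ_succ (n k : ℕ) : greedyTail (n + 1) (k + 1) =
    (1 - 1 / 2 ^ k) * greedyTail n (k + 1) + 1 / 2 ^ k * greedyTail n k := by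
  classical
  set g : SimpleGraph (Fin n) → ℕ := fun G => greedySize n G 1 with hg
  have hfib : ∀ H : SimpleGraph (Fin n), ((Finset.univ.filter fun T : Finset (Fin n) =>
      k + 1 ≤ g H + if Disjoint T (greedyStableSet H (List.finRange n)) then 1 else 0).card : ℝ) =
      2 ^ n * ((1 - 1 / 2 ^ k) * (if k + 1 ≤ g H then 1 else 0) +
        1 / 2 ^ k * (if k ≤ g H then 1 else 0)) := fun H => by
    have hS : (greedyStableSet H (List.finRange n)).card = g H := by simp [hg, greedySize]
    rcases lt_trichotomy k (g H) with hk | hk | hk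
    · rw [Finset.filter_true_of_mem (fun T _ => by omega), if_pos (by omega), if_pos (by omega)]
      simp
    · have : (Finset.univ.filter fun T : Finset (Fin n) =>
          k + 1 ≤ g H + if Disjoint T (greedyStableSet H (List.finRange n)) then 1 else 0) =
          (greedyStableSet H (List.finRange n))ᶜ.powerset := by
        ext T
        simp only [Finset.mem_filter, Finset.mem_univ, true_and, Finset.mem_powerset, hk,
          ← le_compl_iff_disjoint_right]
        split_ifs with h <;> simp [h]
      rw [this, Finset.card_powerset, Finset.card_compl, hS, if_neg (by omega), if_pos (by omega),
        ← hk, Fintype.card_fin]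
      have hkn : k ≤ n := hk ▸ greedySize_le n H 1
      push_cast
      rw [pow_sub₀ _ two_ne_zero hkn]
      ring
    · rw [Finset.filter_false_of_mem (fun T _ => by split_ifs <;> omega), if_neg (by omega),
        if_neg (by omega)]
      simp
  have hcard : (Nat.card (SimpleGraph (Fin (n + 1))) : ℝ) =
      Nat.card (SimpleGraph (Fin n)) * 2 ^ n := by
    rw [Nat.card_congr (simpleGraphFinSuccEquiv n), Nat.card_prod]
    simp
  have hpos : (Nat.card (SimpleGraph (Fin n)) : ℝ) ≠ 0 := by
    exact_mod_cast Nat.card_pos.ne'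
  have hnum : ((Finset.univ.filter fun G : SimpleGraph (Fin (n + 1)) =>
      k + 1 ≤ greedySize (n + 1) G 1).card : ℝ) = ∑ H : SimpleGraph (Fin n),
        2 ^ n * ((1 - 1 / 2 ^ k) * (if k + 1 ≤ g H then 1 else 0) +
        1 / 2 ^ k * (if k ≤ g H then 1 else 0)) := by
    simp_rw [← hfib, Finset.card_filter]
    push_cast
    rw [← Fintype.sum_prod_type', ← Equiv.sum_comp (simpleGraphFinSuccEquiv n)]
    simp only [greedySize_succ, hg]
  rw [greedyTail_eq_div, greedyTail_eq_div, greedyTail_eq_div, hnum, hcard, Finset.card_filter,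
    Finset.card_filter, ← Finset.mul_sum, Finset.sum_add_distrib, ← Finset.mul_sum,
    ← Finset.mul_sum]
  push_cast
  field_simp
  ring

theorem greedyTail_zero_right (n : ℕ) : greedyTail n 0 = 1 := by
  simp [greedyTail]

theorem greedyTail_eq_zero {n k : ℕ} (h : n < k) : greedyTail n k = 0 := by
  have : {x : SimpleGraph (Fin n) × Equiv.Perm (Fin n) | k ≤ greedySize n x.1 x.2} = ∅ := by
    ext x
    have := greedySize_le n x.1 x.2
    simp
    omega
  simp [greedyTail, this]

theorem greedyTail_nonneg (n k : ℕ) : 0 ≤ greedyTail n k := measureReal_nonneg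

theorem greedyTail_le_one (n k : ℕ) : greedyTail n k ≤ 1 := measureReal_le_one

/-! ### Averaging a distribution function against an exponential variable. -/

theorem expMeasure_eq_withDensity (r : ℝ) :
    expMeasure r = volume.withDensity fun x => ENNReal.ofReal (exponentialPDFReal r x) := rfl

theorem exponentialPDFReal_eq_indicator (r : ℝ) : exponentialPDFReal r =
    (Set.Ici 0).indicator fun x => r * Real.exp (-(r * x)) := by
  ext x
  rw [exponentialPDFReal, gammaPDFReal]
  by_cases hx : 0 ≤ x <;> simp [hx]

theorem integral_expMeasure {r : ℝ} (hr : 0 < r) (f : ℝ → ℝ) :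
    ∫ x, f x ∂(expMeasure r) = ∫ x in Set.Ioi 0, r * Real.exp (-(r * x)) * f x := by
  rw [expMeasure_eq_withDensity, integral_withDensity_eq_integral_toReal_smul
    (measurable_exponentialPDFReal r).ennreal_ofReal (ae_of_all _ fun _ => ENNReal.ofReal_lt_top),
    ← integral_Ici_eq_integral_Ioi, ← integral_indicator measurableSet_Ici]
  congr 1
  ext x
  rw [ENNReal.toReal_ofReal (exponentialPDFReal_nonneg hr x), exponentialPDFReal_eq_indicator]
  by_cases hx : 0 ≤ x <;> simp [hx]

theorem integrableOn_of_integrable_expMeasure {r : ℝ} (hr : 0 < r) {f : ℝ → ℝ}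
    (hf : Integrable f (expMeasure r)) :
    IntegrableOn (fun x => r * Real.exp (-(r * x)) * f x) (Set.Ioi 0) := by
  rw [expMeasure_eq_withDensity, integrable_withDensity_iff_integrable_smul'
    (measurable_exponentialPDFReal r).ennreal_ofReal
    (ae_of_all _ fun _ => ENNReal.ofReal_lt_top)] at hf
  refine (hf.integrableOn (s := Set.Ioi 0)).congr_fun (fun x hx => ?_) measurableSet_Ioi
  simp only
  rw [ENNReal.toReal_ofReal (exponentialPDFReal_nonneg hr x), exponentialPDFReal_eq_indicator,
    Set.indicator_of_mem (Set.Ioi_subset_Ici_self hx), smul_eq_mul]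

/-- The memoryless property of the exponential law. -/
theorem integral_expMeasure_memoryless {r h : ℝ} (hr : 0 < r) (hh : 0 ≤ h) {f : ℝ → ℝ}
    (hf : Integrable f (expMeasure r)) :
    ∫ x, f x ∂(expMeasure r) = (∫ x in 0..h, r * Real.exp (-(r * x)) * f x) +
      Real.exp (-(r * h)) * ∫ x, f (x + h) ∂(expMeasure r) := by
  have hi := integrableOn_of_integrable_expMeasure hr hf
  have hu : Set.Ioi (0 : ℝ) = Set.Ioc 0 h ∪ Set.Ioi h := (Set.Ioc_union_Ioi_eq_Ioi hh).symm
  rw [integral_expMeasure hr, integral_expMeasure hr, hu, setIntegral_union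
    (Set.Ioc_disjoint_Ioi le_rfl) measurableSet_Ioi (hi.mono_set (hu ▸ Set.subset_union_left))
    (hi.mono_set (hu ▸ Set.subset_union_right)), ← hu, intervalIntegral.integral_of_le hh,
    ← integral_const_mul]
  congr 1
  have := (measurePreserving_add_right volume h).setIntegral_preimage_emb
    (measurableEmbedding_addRight h) (fun x => r * Real.exp (-(r * x)) * f x) (Set.Ioi h)
  rw [Set.preimage_add_const_Ioi, sub_self] at this
  rw [← this]
  congr 1
  ext x
  rw [mul_add, neg_add, Real.exp_add]
  ring

theorem integral_exp_density {r h : ℝ} :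
    ∫ x in 0..h, r * Real.exp (-(r * x)) = 1 - Real.exp (-(r * h)) := by
  rw [intervalIntegral.integral_eq_sub_of_hasDerivAt
    (fun x _ => hasDerivAt_neg_exp_mul_exp (r := r) (x := x))]
  · simp; ring
  · exact Continuous.intervalIntegrable (by fun_prop) _ _

theorem integrable_comp_sub {V : ℝ → ℝ} (hV : Monotone V) (h0 : ∀ x, 0 ≤ V x) (h1 : ∀ x, V x ≤ 1)
    (ν : Measure ℝ) [IsFiniteMeasure ν] (y : ℝ) : Integrable (fun s => V (y - s)) ν := by
  refine Integrable.of_bound (hV.measurable.comp (by fun_prop)).aestronglyMeasurable 1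
    (ae_of_all _ fun s => ?_)
  rw [Real.norm_eq_abs, abs_of_nonneg (h0 _)]
  exact h1 _

/-- The variable either exceeds `h`, and then restarts from `y`, or does not, and then monotonicity
bounds the integrand by its value at `y + h`. -/
theorem integral_comp_sub_expMeasure_le {V : ℝ → ℝ} (hV : Monotone V)
    (h0 : ∀ x, 0 ≤ V x) (h1 : ∀ x, V x ≤ 1) {r h : ℝ} (hr : 0 < r) (hh : 0 ≤ h) (y : ℝ) :
    ∫ s, V (y + h - s) ∂(expMeasure r) ≤
      Real.exp (-(r * h)) * ∫ s, V (y - s) ∂(expMeasure r) +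
        (1 - Real.exp (-(r * h))) * V (y + h) := by
  have := isProbabilityMeasure_expMeasure hr
  rw [integral_expMeasure_memoryless hr hh (integrable_comp_sub hV h0 h1 _ _),
    ← integral_exp_density, ← intervalIntegral.integral_mul_const, add_comm]
  simp only [add_sub_add_right_eq_sub]
  gcongr 1
  refine intervalIntegral.integral_mono_on hh ?_ ?_ fun x hx => ?_
  · rw [intervalIntegrable_iff_integrableOn_Ioc_of_le hh]
    exact (integrableOn_of_integrable_expMeasure hr
      (integrable_comp_sub hV h0 h1 _ (y + h))).mono_set Set.Ioc_subset_Ioi_self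
  · exact Continuous.intervalIntegrable (by fun_prop) _ _
  · have := hV (show y + h - x ≤ y + h by linarith [hx.1])
    gcongr

theorem le_integral_comp_sub_expMeasure {V : ℝ → ℝ} (hV : Monotone V)
    (h0 : ∀ x, 0 ≤ V x) (h1 : ∀ x, V x ≤ 1) {r h : ℝ} (hr : 0 < r) (hh : 0 ≤ h) (y : ℝ) :
    Real.exp (-(r * h)) * ∫ s, V (y - s) ∂(expMeasure r) + (1 - Real.exp (-(r * h))) * V y ≤
      ∫ s, V (y + h - s) ∂(expMeasure r) := by
  have := isProbabilityMeasure_expMeasure hr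
  rw [integral_expMeasure_memoryless hr hh (integrable_comp_sub hV h0 h1 _ (y + h)),
    ← integral_exp_density, ← intervalIntegral.integral_mul_const, add_comm]
  simp only [add_sub_add_right_eq_sub]
  gcongr 1
  refine intervalIntegral.integral_mono_on hh ?_ ?_ fun x hx => ?_
  · exact Continuous.intervalIntegrable (by fun_prop) _ _
  · rw [intervalIntegrable_iff_integrableOn_Ioc_of_le hh]
    exact (integrableOn_of_integrable_expMeasure hr
      (integrable_comp_sub hV h0 h1 _ (y + h))).mono_set Set.Ioc_subset_Ioi_self
  · have := hV (show y ≤ y + h - x by linarith [hx.2])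
    gcongr

theorem integral_comp_sub_expMeasure_le_self {V : ℝ → ℝ} (hV : Monotone V)
    (h0 : ∀ x, 0 ≤ V x) (h1 : ∀ x, V x ≤ 1) {r : ℝ} (hr : 0 < r) (y : ℝ) :
    ∫ s, V (y - s) ∂(expMeasure r) ≤ V y := by
  have := isProbabilityMeasure_expMeasure hr
  calc ∫ s, V (y - s) ∂(expMeasure r) ≤ ∫ s, V y ∂(expMeasure r) := by
        refine integral_mono_ae (integrable_comp_sub hV h0 h1 _ y) (integrable_const _) ?_
        filter_upwards [ae_nonneg_expMeasure] with s hs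
        exact hV (by linarith)
    _ = V y := by simp

theorem sub_integral_comp_sub_expMeasure_le {V : ℝ → ℝ} (hV : Monotone V)
    (h0 : ∀ x, 0 ≤ V x) (h1 : ∀ x, V x ≤ 1) {r L : ℝ} (hr : 0 < r) (hL : 0 ≤ L)
    (hlip : ∀ x h, 0 ≤ h → V (x + h) ≤ V x + L * h) (y : ℝ) :
    V y ≤ ∫ s, V (y - s) ∂(expMeasure r) + L / r := by
  have := isProbabilityMeasure_expMeasure hr
  have hfin := lintegral_expMeasure_le hr
  have hint : Integrable (fun s : ℝ => s) (expMeasure r) := by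
    refine ⟨by fun_prop, ?_⟩
    rw [hasFiniteIntegral_iff_ofReal ae_nonneg_expMeasure]
    exact hfin.trans_lt ENNReal.ofReal_lt_top
  have hmean : ∫ s, s ∂(expMeasure r) ≤ 1 / r := by
    rw [integral_eq_lintegral_of_nonneg_ae ae_nonneg_expMeasure (by fun_prop)]
    exact ENNReal.toReal_le_of_le_ofReal (by positivity) hfin
  calc V y = ∫ s, V y ∂(expMeasure r) := by simp
    _ ≤ ∫ s, (V (y - s) + L * s) ∂(expMeasure r) := by
        refine integral_mono_ae (integrable_const _)
          ((integrable_comp_sub hV h0 h1 _ y).add (hint.const_mul L)) ?_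
        filter_upwards [ae_nonneg_expMeasure] with s hs
        simpa using hlip (y - s) s hs
    _ = ∫ s, V (y - s) ∂(expMeasure r) + L * ∫ s, s ∂(expMeasure r) := by
        rw [integral_add (integrable_comp_sub hV h0 h1 _ y) (hint.const_mul L),
          integral_const_mul]
    _ ≤ _ := by
        rw [div_eq_mul_one_div]
        gcongr

/-- The factor `r / (r - 1)` is the exponential moment of `Exp(r)` at `1`, hence the need for `1 <
r`. -/
theorem one_sub_integral_comp_sub_expMeasure_le {V : ℝ → ℝ} (hV : Monotone V)
    (h0 : ∀ x, 0 ≤ V x) (h1 : ∀ x, V x ≤ 1) {r a : ℝ} (hr : 1 < r)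
    (htail : ∀ x, 1 - V x ≤ a * Real.exp (-x)) (y : ℝ) :
    1 - ∫ s, V (y - s) ∂(expMeasure r) ≤ a * (r / (r - 1)) * Real.exp (-y) := by
  have hr0 : 0 < r := by linarith
  have := isProbabilityMeasure_expMeasure hr0
  have e : ∀ s : ℝ, r * Real.exp (-(r * s)) * (a * Real.exp (-(y - s))) =
      a * r * Real.exp (-y) * Real.exp (-(r - 1) * s) := fun s => by
    have : Real.exp (-(r * s)) * Real.exp (-(y - s)) =
        Real.exp (-y) * Real.exp (-(r - 1) * s) := by
      rw [← Real.exp_add, ← Real.exp_add]; ring_nf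
    linear_combination a * r * this
  calc 1 - ∫ s, V (y - s) ∂(expMeasure r) = ∫ s, (1 - V (y - s)) ∂(expMeasure r) := by
        rw [integral_sub (integrable_const _) (integrable_comp_sub hV h0 h1 _ y)]
        simp
    _ ≤ ∫ x in Set.Ioi 0, r * Real.exp (-(r * x)) * (a * Real.exp (-(y - x))) := by
        rw [integral_expMeasure hr0]
        refine setIntegral_mono_on (integrableOn_of_integrable_expMeasure hr0
          ((integrable_const _).sub (integrable_comp_sub hV h0 h1 _ y))) ?_ measurableSet_Ioi
          fun x _ => ?_
        · simp only [e]
          exact (integrableOn_exp_mul_Ioi (by linarith) 0).const_mul _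
        · exact mul_le_mul_of_nonneg_left (htail _) (by positivity)
    _ = _ := by
        simp only [e]
        rw [integral_const_mul, integral_exp_mul_Ioi (by linarith)]
        have : r - 1 ≠ 0 := by linarith
        rw [mul_zero, Real.exp_zero, neg_div_neg_eq]
        field_simp

/-! ### Laws of the partial sums and their self-similarity. -/

theorem cdf_conv (μ ν : Measure ℝ) [IsProbabilityMeasure μ] [IsProbabilityMeasure ν] (x : ℝ) :
    cdf (μ ∗ ν) x = ∫ s, cdf μ (x - s) ∂ν := by
  have hint : Integrable ((Set.Iic x).indicator fun _ => (1 : ℝ)) (ν ∗ μ) :=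
    (integrable_const _).indicator measurableSet_Iic
  rw [Measure.conv_comm, cdf_eq_real, ← integral_indicator_one measurableSet_Iic]
  erw [integral_conv hint]
  congr 1
  ext s
  rw [cdf_eq_real, ← integral_indicator_one measurableSet_Iic]
  congr 1
  ext y
  simp [Set.indicator_apply, le_sub_iff_add_le']

/-- The law of the sum of the first `m` coordinates under `expSeqMeasure`. -/
noncomputable def hypoPartialLaw : ℕ → Measure ℝ
  | 0 => Measure.dirac 0
  | m + 1 => hypoPartialLaw m ∗ expMeasure (2 ^ (m + 1))

instance isProbabilityMeasure_hypoPartialLaw (m : ℕ) :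
    IsProbabilityMeasure (hypoPartialLaw m) := by
  induction m with
  | zero => rw [hypoPartialLaw]; infer_instance
  | succ m ih => rw [hypoPartialLaw]; infer_instance

theorem map_sum_expSeqMeasure (m : ℕ) :
    expSeqMeasure.map (fun x => ∑ i ∈ Finset.range m, x i) = hypoPartialLaw m := by
  induction m with
  | zero => simp [hypoPartialLaw]
  | succ m ih =>
    have hind : iIndepFun (fun (i : ℕ) (x : ℕ → ℝ) => x i) expSeqMeasure :=
      iIndepFun_infinitePi (X := fun _ x => x) fun _ => measurable_id
    have h := (hind.indepFun_sum_range_succ (fun i => measurable_pi_apply i)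
      m).map_add_eq_map_conv_map (by fun_prop) (by fun_prop)
    have hm : expSeqMeasure.map (fun x : ℕ → ℝ => x m) = expMeasure (2 ^ (m + 1)) :=
      (measurePreserving_eval_infinitePi (fun i : ℕ => expMeasure ((2 : ℝ) ^ (i + 1))) m).map_eq
    rw [hypoPartialLaw, ← ih, ← hm]
    convert h using 2
    · ext x
      simp [Finset.sum_range_succ]
    · congr 1
      ext x
      simp

theorem map_half_expMeasure {r : ℝ} (hr : 0 < r) :
    (expMeasure r).map (fun x => x / 2) = expMeasure (r * 2) := by
  have := isProbabilityMeasure_expMeasure hr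
  have := isProbabilityMeasure_expMeasure (show 0 < r * 2 by positivity)
  have hm : Measurable fun x : ℝ => x / 2 := by fun_prop
  have := Measure.isProbabilityMeasure_map (μ := expMeasure r) hm.aemeasurable
  refine Measure.eq_of_cdf _ _ ?_
  ext x
  have hp : (fun x : ℝ => x / 2) ⁻¹' Set.Iic x = Set.Iic (x * 2) := by
    ext y
    simp [div_le_iff₀]
  rw [cdf_eq_real, map_measureReal_apply hm measurableSet_Iic, hp, ← cdf_eq_real,
    cdf_expMeasure_eq hr, cdf_expMeasure_eq (by positivity)]
  have : 0 ≤ x * 2 ↔ 0 ≤ x := by constructor <;> intro <;> linarith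
  simp only [this]
  ring_nf

/-- Halving turns the rates `2, …, 2^m` into `4, …, 2^(m+1)`, so only the rate `2` is missing. This
peels off the slowest variable, where the definition peels off the fastest. -/
theorem hypoPartialLaw_succ (m : ℕ) :
    hypoPartialLaw (m + 1) = (hypoPartialLaw m).map (fun x => x / 2) ∗ expMeasure 2 := by
  induction m with
  | zero =>
    have h0 : hypoPartialLaw 0 = Measure.dirac 0 := rfl
    have h1 : hypoPartialLaw (0 + 1) = hypoPartialLaw 0 ∗ expMeasure (2 ^ (0 + 1)) := rfl
    have hm : Measurable fun x : ℝ => x / 2 := by fun_prop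
    rw [h1, h0, Measure.map_dirac' hm]
    simp
  | succ m ih =>
    have hmap := Measure.map_conv_addMonoidHom (μ := hypoPartialLaw m)
      (ν := expMeasure (2 ^ (m + 1))) (AddMonoidHom.mulRight (2⁻¹ : ℝ)) (by
        simp only [AddMonoidHom.coe_mulRight]; fun_prop)
    simp only [AddMonoidHom.coe_mulRight, ← div_eq_mul_inv] at hmap
    rw [map_half_expMeasure (by positivity), ← pow_succ] at hmap
    have : IsProbabilityMeasure (expMeasure (2 : ℝ)) := isProbabilityMeasure_expMeasure two_pos
    have h1 : hypoPartialLaw (m + 1) = hypoPartialLaw m ∗ expMeasure (2 ^ (m + 1)) := rfl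
    have h2 : hypoPartialLaw (m + 1 + 1) =
      hypoPartialLaw (m + 1) ∗ expMeasure (2 ^ (m + 1 + 1)) := rfl
    rw [h2]
    conv_lhs => rw [ih]
    conv_rhs => rw [h1, hmap]
    rw [Measure.conv_assoc, Measure.conv_comm (expMeasure 2), ← Measure.conv_assoc]

/-! ### Distribution functions of the partial sums: recurrence, regularity, tail. -/

/-- Distribution function of `∑_{i < m} x i` under `expSeqMeasure`. -/
noncomputable def hypoPartialCDF (m : ℕ) (x : ℝ) : ℝ := cdf (hypoPartialLaw m) x

theorem monotone_hypoPartialCDF (m : ℕ) : Monotone (hypoPartialCDF m) := monotone_cdf _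

theorem hypoPartialCDF_nonneg (m : ℕ) (x : ℝ) : 0 ≤ hypoPartialCDF m x := cdf_nonneg _ _

theorem hypoPartialCDF_le_one (m : ℕ) (x : ℝ) : hypoPartialCDF m x ≤ 1 := cdf_le_one _ _

theorem hypoPartialCDF_zero (x : ℝ) : hypoPartialCDF 0 x = if 0 ≤ x then 1 else 0 := by
  rw [hypoPartialCDF, hypoPartialLaw, cdf_eq_real, measureReal_def,
    Measure.dirac_apply' _ measurableSet_Iic]
  by_cases hx : 0 ≤ x <;> simp [hx]

theorem hypoPartialCDF_succ (m : ℕ) (x : ℝ) :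
    hypoPartialCDF (m + 1) x = ∫ s, hypoPartialCDF m (x - s) ∂(expMeasure (2 ^ (m + 1))) :=
  cdf_conv _ _ _

theorem hypoPartialCDF_succ' (m : ℕ) (x : ℝ) :
    hypoPartialCDF (m + 1) x = ∫ s, hypoPartialCDF m (2 * (x - s)) ∂(expMeasure 2) := by
  have : IsProbabilityMeasure (expMeasure (2 : ℝ)) := isProbabilityMeasure_expMeasure two_pos
  have hm : Measurable fun x : ℝ => x / 2 := by fun_prop
  have := Measure.isProbabilityMeasure_map (μ := hypoPartialLaw m) hm.aemeasurable
  rw [hypoPartialCDF, hypoPartialLaw_succ, cdf_conv]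
  congr 1
  ext s
  rw [hypoPartialCDF, cdf_eq_real, map_measureReal_apply hm measurableSet_Iic, cdf_eq_real]
  congr 1
  ext y
  simp [div_le_iff₀, mul_comm]

/-- A discrete form of `F_{m+1}'(x) = 2 (F_m(2x) - F_{m+1}(x))`, shaped like `greedyTail_succ_succ`
with `exp(-2h)` in the role of `1 - 2^(-k)`. -/
theorem hypoPartialCDF_succ_add_le (m : ℕ) (x : ℝ) {h : ℝ} (hh : 0 ≤ h) :
    hypoPartialCDF (m + 1) (x + h) ≤ Real.exp (-(2 * h)) * hypoPartialCDF (m + 1) x +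
      (1 - Real.exp (-(2 * h))) * hypoPartialCDF m (2 * (x + h)) := by
  rw [hypoPartialCDF_succ', hypoPartialCDF_succ']
  exact integral_comp_sub_expMeasure_le (V := fun x => hypoPartialCDF m (2 * x))
    (fun a b hab => monotone_hypoPartialCDF m (by linarith))
    (fun _ => hypoPartialCDF_nonneg _ _) (fun _ => hypoPartialCDF_le_one _ _) two_pos hh x

theorem le_hypoPartialCDF_succ_add (m : ℕ) (x : ℝ) {h : ℝ} (hh : 0 ≤ h) :
    Real.exp (-(2 * h)) * hypoPartialCDF (m + 1) x +
      (1 - Real.exp (-(2 * h))) * hypoPartialCDF m (2 * x) ≤ hypoPartialCDF (m + 1) (x + h) := by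
  rw [hypoPartialCDF_succ', hypoPartialCDF_succ']
  exact le_integral_comp_sub_expMeasure (V := fun x => hypoPartialCDF m (2 * x))
    (fun a b hab => monotone_hypoPartialCDF m (by linarith))
    (fun _ => hypoPartialCDF_nonneg _ _) (fun _ => hypoPartialCDF_le_one _ _) two_pos hh x

theorem hypoPartialCDF_add_le {m : ℕ} (hm : m ≠ 0) (x : ℝ) {h : ℝ} (hh : 0 ≤ h) :
    hypoPartialCDF m (x + h) ≤ hypoPartialCDF m x + 2 * h := by
  obtain ⟨m, rfl⟩ := Nat.exists_eq_succ_of_ne_zero hm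
  have h1 := hypoPartialCDF_succ_add_le m x hh
  have h2 : 1 - 2 * h ≤ Real.exp (-(2 * h)) := by
    linarith [Real.add_one_le_exp (-(2 * h))]
  have h3 := hypoPartialCDF_nonneg (m + 1) x
  have h4 := hypoPartialCDF_le_one m (2 * (x + h))
  have h5 : Real.exp (-(2 * h)) ≤ 1 := Real.exp_le_one_iff.2 (by linarith)
  rw [Nat.succ_eq_add_one]
  nlinarith

theorem hypoPartialCDF_succ_le (m : ℕ) (x : ℝ) :
    hypoPartialCDF (m + 1) x ≤ hypoPartialCDF m x := by
  rw [hypoPartialCDF_succ]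
  exact integral_comp_sub_expMeasure_le_self (monotone_hypoPartialCDF m)
    (hypoPartialCDF_nonneg m) (hypoPartialCDF_le_one m) (by positivity) x

theorem antitone_hypoPartialCDF (x : ℝ) : Antitone fun m => hypoPartialCDF m x :=
  antitone_nat_of_succ_le fun m => hypoPartialCDF_succ_le m x

/-- The added variable has mean `2^(-(m+1))` and the distribution function is 2-Lipschitz once `m ≠
0`. -/
theorem hypoPartialCDF_le_succ_add {m : ℕ} (hm : m ≠ 0) (x : ℝ) :
    hypoPartialCDF m x ≤ hypoPartialCDF (m + 1) x + 2 / 2 ^ (m + 1) := by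
  rw [hypoPartialCDF_succ]
  exact sub_integral_comp_sub_expMeasure_le (monotone_hypoPartialCDF m)
    (hypoPartialCDF_nonneg m) (hypoPartialCDF_le_one m) (by positivity) zero_le_two
    (fun x h hh => hypoPartialCDF_add_le hm x hh) x

theorem hypoPartialCDF_le_add {m : ℕ} (hm : m ≠ 0) (j : ℕ) (x : ℝ) :
    hypoPartialCDF m x ≤ hypoPartialCDF (m + j) x + (2 / 2 ^ m - 2 / 2 ^ (m + j)) := by
  induction j with
  | zero => simp
  | succ j ih =>
    have := hypoPartialCDF_le_succ_add (m := m + j) (by omega) x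
    have e : (2 : ℝ) / 2 ^ (m + j) = 2 * (2 / 2 ^ (m + j + 1)) := by
      rw [pow_succ]; field_simp
    rw [← add_assoc]
    linarith

theorem one_sub_hypoPartialCDF_le (m : ℕ) (x : ℝ) :
    1 - hypoPartialCDF m x ≤ 4 * Real.exp (-x) := by
  -- The constant is exact for one variable and, with `u = 2^(m+1)`, absorbs the next moment factor:
  -- `(1 - 1/u) * 2u/(2u - 1) ≤ 1 - 1/(2u)`.
  have key : ∀ m : ℕ, ∀ x, 1 - hypoPartialCDF (m + 1) x ≤
      4 * (1 - 1 / 2 ^ (m + 1)) * Real.exp (-x) := by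
    intro m
    induction m with
    | zero =>
      intro x
      rw [hypoPartialCDF_succ]
      have h := one_sub_integral_comp_sub_expMeasure_le (r := 2 ^ (0 + 1)) (a := 1)
        (monotone_hypoPartialCDF 0) (hypoPartialCDF_nonneg 0) (hypoPartialCDF_le_one 0)
        (by norm_num) (fun x => ?_) x
      · refine h.trans (le_of_eq ?_)
        norm_num
      · rw [hypoPartialCDF_zero]
        split_ifs with hx
        · simp [Real.exp_nonneg]
        · simp only [sub_zero, one_mul]
          exact Real.one_le_exp (by linarith)
    | succ m ih =>
      intro x
      rw [hypoPartialCDF_succ]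
      have h2 : (1 : ℝ) < 2 ^ (m + 1 + 1) := one_lt_pow₀ one_lt_two (by omega)
      refine (one_sub_integral_comp_sub_expMeasure_le
        (monotone_hypoPartialCDF _) (hypoPartialCDF_nonneg _) (hypoPartialCDF_le_one _)
        h2 ih x).trans ?_
      gcongr ?_ * _
      rw [pow_succ _ (m + 1)] at h2 ⊢
      generalize (2 : ℝ) ^ (m + 1) = u at *
      have hu : 0 < u := by linarith
      have hu2 : 0 < u * 2 - 1 := by linarith
      rw [mul_div_assoc', div_le_iff₀ hu2]
      field_simp
      nlinarith
  rcases m with _ | m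
  · exact (sub_le_sub_left (hypoPartialCDF_succ_le 0 x) 1).trans ((key 0 x).trans (by
      gcongr; norm_num))
  · refine (key m x).trans ?_
    have : (0 : ℝ) ≤ 1 / 2 ^ (m + 1) := by positivity
    gcongr
    linarith

theorem hypoPartialCDF_of_neg (m : ℕ) {x : ℝ} (hx : x < 0) : hypoPartialCDF m x = 0 := by
  refine le_antisymm ?_ (hypoPartialCDF_nonneg _ _)
  refine (antitone_hypoPartialCDF x (Nat.zero_le m)).trans ?_
  simp [hypoPartialCDF_zero, hx.not_ge]

/-! ### Passage to the limit law. -/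

/-- Distribution function of `hypo`. -/
noncomputable def hypoCDF (x : ℝ) : ℝ := expSeqMeasure.real {y | hypo y ≤ x}

theorem ae_nonneg_expSeqMeasure : ∀ᵐ x ∂expSeqMeasure, ∀ i, 0 ≤ x i :=
  ae_all_iff.2 fun i => (measurePreserving_eval_infinitePi
    (fun i : ℕ => expMeasure ((2 : ℝ) ^ (i + 1))) i).quasiMeasurePreserving.ae ae_nonneg_expMeasure

theorem hypoPartialCDF_eq_real (m : ℕ) (x : ℝ) : hypoPartialCDF m x =
    expSeqMeasure.real {y | ∑ i ∈ Finset.range m, y i ≤ x} := by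
  rw [hypoPartialCDF, ← map_sum_expSeqMeasure]
  have hm : Measurable fun y : ℕ → ℝ => ∑ i ∈ Finset.range m, y i := by fun_prop
  have := Measure.isProbabilityMeasure_map (μ := expSeqMeasure) hm.aemeasurable
  rw [cdf_eq_real, map_measureReal_apply hm measurableSet_Iic]
  rfl

/-- Almost surely the partial sums increase to `hypo`, so the events `{sum ≤ x}` decrease to `{hypo
≤ x}`; monotonicity gives convergence at every `x`. -/
theorem tendsto_hypoPartialCDF (x : ℝ) :
    Tendsto (fun m => hypoPartialCDF m x) atTop (𝓝 (hypoCDF x)) := by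
  simp only [hypoPartialCDF_eq_real, hypoCDF]
  refine (ENNReal.tendsto_toReal (measure_ne_top _ _)).comp ?_
  obtain ⟨g, hg, hge⟩ := aemeasurable_hypo
  have hcongr : expSeqMeasure {y | hypo y ≤ x} = expSeqMeasure {y | g y ≤ x} := by
    refine measure_congr ?_
    filter_upwards [hge] with y hy
    simp only [eq_iff_iff]
    change hypo y ≤ x ↔ g y ≤ x
    rw [hy]
  rw [hcongr]
  refine tendsto_measure_of_ae_tendsto_indicator_of_isFiniteMeasure atTop
    (measurableSet_le hg measurable_const)
    (fun m => measurableSet_le (by fun_prop) measurable_const) ?_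
  filter_upwards [hge, ae_summable_expSeqMeasure, ae_nonneg_expSeqMeasure] with y hy hs h0
  change ∀ᶠ m in atTop, (∑ i ∈ Finset.range m, y i ≤ x ↔ g y ≤ x)
  rw [← hy]
  by_cases hx : hypo y ≤ x
  · exact Eventually.of_forall fun m => iff_of_true
      ((hs.sum_le_tsum _ fun i _ => h0 i).trans hx) hx
  · filter_upwards [hs.hasSum.tendsto_sum_nat.eventually (lt_mem_nhds (not_le.1 hx))] with m hm
    exact iff_of_false (not_le.2 hm) hx

theorem hypoCDF_le_hypoPartialCDF (m : ℕ) (x : ℝ) : hypoCDF x ≤ hypoPartialCDF m x :=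
  (antitone_hypoPartialCDF x).le_of_tendsto (tendsto_hypoPartialCDF x) m

theorem hypoPartialCDF_le_hypoCDF_add {m : ℕ} (hm : m ≠ 0) (x : ℝ) :
    hypoPartialCDF m x ≤ hypoCDF x + 2 / 2 ^ m := by
  refine ge_of_tendsto' (((tendsto_add_atTop_iff_nat m).2 (tendsto_hypoPartialCDF x)).add_const _)
    fun j => (hypoPartialCDF_le_add hm j x).trans ?_
  rw [add_comm j m]
  have : (0 : ℝ) ≤ 2 / 2 ^ (m + j) := by positivity
  linarith

theorem hypoCDF_add_le (x : ℝ) {h : ℝ} (hh : 0 ≤ h) : hypoCDF (x + h) ≤ hypoCDF x + 2 * h := by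
  refine le_of_tendsto_of_tendsto (tendsto_hypoPartialCDF (x + h))
    ((tendsto_hypoPartialCDF x).add_const _) ?_
  filter_upwards [eventually_ne_atTop 0] with m hm
  exact hypoPartialCDF_add_le hm x hh

theorem hypoCDF_nonneg (x : ℝ) : 0 ≤ hypoCDF x := measureReal_nonneg

theorem hypoCDF_le_one (x : ℝ) : hypoCDF x ≤ 1 := measureReal_le_one

theorem one_sub_hypoCDF_le (x : ℝ) : 1 - hypoCDF x ≤ 4 * Real.exp (-x) :=
  le_of_tendsto' ((tendsto_hypoPartialCDF x).const_sub 1) fun m => one_sub_hypoPartialCDF_le m x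

theorem hypoCDF_of_neg {x : ℝ} (hx : x < 0) : hypoCDF x = 0 :=
  tendsto_nhds_unique (tendsto_hypoPartialCDF x) (by simp [hypoPartialCDF_of_neg _ hx])

theorem hypoCDF_le {x : ℝ} (hx : 0 ≤ x) : hypoCDF x ≤ 2 * x := by
  refine le_of_forall_pos_le_add fun ε hε => ?_
  have h := hypoCDF_add_le (-(ε / 2)) (h := x + ε / 2) (by linarith)
  have e : -(ε / 2) + (x + ε / 2) = x := by ring
  rw [e, hypoCDF_of_neg (x := -(ε / 2)) (by linarith)] at h
  linarith

/-- The Lipschitz bound rules out an atom at `x`. -/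
theorem measureReal_hypo_lt (x : ℝ) : expSeqMeasure.real {y | hypo y < x} = hypoCDF x := by
  refine le_antisymm (measureReal_mono fun y (hy : hypo y < x) => hy.le) ?_
  refine le_of_forall_pos_le_add fun ε hε => ?_
  have h := hypoCDF_add_le (x - ε / 2) (h := ε / 2) (by linarith)
  rw [sub_add_cancel] at h
  have h2 : hypoCDF (x - ε / 2) ≤ expSeqMeasure.real {y | hypo y < x} :=
    measureReal_mono fun y hy => by
      simp only [Set.mem_ofPred_eq] at hy ⊢
      linarith
  linarith

theorem qHypo_eq_sub (n k : ℕ) :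
    qHypo n k = hypoCDF ((n : ℝ) / 2 ^ k) - hypoCDF ((n : ℝ) / 2 ^ (k + 1)) := by
  have hle : (n : ℝ) / 2 ^ (k + 1) ≤ n / 2 ^ k := by
    gcongr
    · norm_num
    · omega
  have hnull : NullMeasurableSet {y | hypo y < (n : ℝ) / 2 ^ (k + 1)} expSeqMeasure :=
    nullMeasurableSet_lt aemeasurable_hypo aemeasurable_const
  rw [qHypo, ← measureReal_hypo_lt, ← measureReal_hypo_lt, eq_sub_iff_add_eq,
    ← measureReal_union₀ hnull]
  · congr 1
    ext y
    simp only [Set.mem_union, Set.mem_ofPred_eq]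
    constructor
    · rintro (h | h) <;> linarith [h]
    · intro h
      by_cases h' : hypo y < (n : ℝ) / 2 ^ (k + 1)
      · exact Or.inr h'
      · exact Or.inl ⟨not_lt.1 h', h⟩
  · refine Disjoint.aedisjoint (Set.disjoint_left.2 fun y hy hy' => ?_)
    exact absurd hy' (not_lt.2 hy.1)

/-! ### Comparison of the greedy tail with the partial sums. -/

/-- In coupling terms, a geometric waiting time is at most `1` plus an exponential one of the same
rate; the `k` added units make the shift `n - k`. -/
theorem hypoPartialCDF_le_greedyTail (n k : ℕ) :
    hypoPartialCDF k (((n : ℝ) - k) / 2 ^ k) ≤ greedyTail n k := by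
  induction n generalizing k with
  | zero =>
    rcases k with _ | k
    · rw [greedyTail_zero_right]
      exact hypoPartialCDF_le_one _ _
    · rw [hypoPartialCDF_of_neg]
      · exact greedyTail_nonneg _ _
      · refine div_neg_of_neg_of_pos ?_ (by positivity)
        push_cast
        linarith [(Nat.cast_nonneg k : (0 : ℝ) ≤ k)]
  | succ n ih =>
    rcases k with _ | k
    · rw [greedyTail_zero_right]
      exact hypoPartialCDF_le_one _ _
    set l : ℝ := 1 / 2 ^ k with hl
    have hl0 : 0 < l := by positivity
    have hl1 : l ≤ 1 := by
      rw [hl, div_le_one (by positivity)]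
      exact one_le_pow₀ one_le_two
    have i1 := ih (k + 1)
    have i2 := ih k
    set x : ℝ := ((n : ℝ) - (k + 1 : ℕ)) / 2 ^ (k + 1) with hx
    have e1 : (((n + 1 : ℕ) : ℝ) - (k + 1 : ℕ)) / 2 ^ (k + 1) = x + l / 2 := by
      rw [hx, hl, pow_succ]
      push_cast
      field_simp
      ring
    have e2 : ((n : ℝ) - k) / 2 ^ k = 2 * (x + l / 2) := by
      rw [hx, hl, pow_succ]
      push_cast
      field_simp
      ring
    -- One scanned vertex advances the argument by `l / 2`, for which the exponential weight is
    -- `exp(-l) ≥ 1 - l`.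
    have h := hypoPartialCDF_succ_add_le k x (h := l / 2) (by positivity)
    rw [e1, greedyTail_succ_succ]
    rw [e2] at i2
    have hle : hypoPartialCDF (k + 1) x ≤ hypoPartialCDF k (2 * (x + l / 2)) := by
      rcases lt_or_ge x 0 with h0 | h0
      · rw [hypoPartialCDF_of_neg _ h0]
        exact hypoPartialCDF_nonneg _ _
      · exact (hypoPartialCDF_succ_le k x).trans (monotone_hypoPartialCDF k (by linarith))
    have he : 1 - l ≤ Real.exp (-(2 * (l / 2))) := by
      linarith [Real.add_one_le_exp (-(2 * (l / 2)))]
    nlinarith [mul_nonneg (sub_nonneg.2 he) (sub_nonneg.2 hle),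
      mul_nonneg (sub_nonneg.2 hl1) (sub_nonneg.2 i1), mul_nonneg hl0.le (sub_nonneg.2 i2)]

/-- Discarding the first `j` waiting times leaves success probabilities `l ≤ 2^(-j)`. Such a
geometric time dominates `1 - 2^(-j)` times an exponential one of rate `l`. -/
theorem greedyTail_le_hypoPartialCDF {j : ℕ} (hj : j ≠ 0) (n i : ℕ) :
    greedyTail n (j + i) ≤ hypoPartialCDF i (n / (1 - 1 / 2 ^ j) / 2 ^ (j + i)) := by
  have h2j : (1 : ℝ) / 2 ^ j ≤ 1 / 2 := by
    have : (2 : ℝ) ^ 1 ≤ 2 ^ j := pow_le_pow_right₀ one_le_two (by omega)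
    gcongr
    simpa using this
  have hd : (0 : ℝ) < 1 - 1 / 2 ^ j := by linarith
  induction n generalizing i with
  | zero =>
    rcases i with _ | i
    · simp [hypoPartialCDF_zero, greedyTail_le_one]
    · rw [greedyTail_eq_zero (by omega)]
      exact hypoPartialCDF_nonneg _ _
  | succ n ih =>
    rcases i with _ | i
    · rw [hypoPartialCDF_zero, if_pos (by positivity)]
      exact greedyTail_le_one _ _
    have i1 := ih (i + 1)
    have i2 := ih i
    rw [← add_assoc] at i1 ⊢
    set l : ℝ := 1 / 2 ^ (j + i) with hl
    have hl0 : 0 < l := by positivity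
    have hlj : l ≤ 1 / 2 ^ j := by
      rw [hl]
      gcongr
      · exact one_le_two
      · omega
    set c : ℝ := 1 / (1 - 1 / 2 ^ j) with hc
    have hc0 : 0 < c := by positivity
    have hcl : 1 ≤ c * (1 - l) := by
      rw [hc, div_mul_eq_mul_div, one_le_div hd]
      linarith
    set x : ℝ := (n : ℝ) / (1 - 1 / 2 ^ j) / 2 ^ (j + i + 1) with hx
    have e1 : ((n + 1 : ℕ) : ℝ) / (1 - 1 / 2 ^ j) / 2 ^ (j + i + 1) = x + c * l / 2 := by
      rw [hx, hl, hc, pow_succ]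
      push_cast
      field_simp
    have e2 : (n : ℝ) / (1 - 1 / 2 ^ j) / 2 ^ (j + i) = 2 * x := by
      rw [hx, pow_succ]
      field_simp
    have hx0 : 0 ≤ x := by positivity
    have h := le_hypoPartialCDF_succ_add i x (h := c * l / 2) (by positivity)
    rw [e1, greedyTail_succ_succ]
    rw [e2] at i2
    have hle : hypoPartialCDF (i + 1) x ≤ hypoPartialCDF i (2 * x) :=
      (hypoPartialCDF_succ_le i x).trans (monotone_hypoPartialCDF i (by linarith))
    -- The dilation `c` is chosen for this: `exp(c l) ≥ 1 + c l ≥ 1 / (1 - l)` because `c (1 - l) ≥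
    -- 1`.
    have he : Real.exp (-(2 * (c * l / 2))) ≤ 1 - l := by
      rw [Real.exp_neg, inv_le_comm₀ (Real.exp_pos _) (by linarith)]
      refine le_trans ?_ (Real.add_one_le_exp _)
      rw [inv_le_iff_one_le_mul₀ (by linarith)]
      nlinarith [mul_le_mul_of_nonneg_left hcl hl0.le]
    nlinarith [mul_nonneg (sub_nonneg.2 he) (sub_nonneg.2 hle),
      mul_nonneg (show 0 ≤ 1 - l by linarith) (sub_nonneg.2 i1),
      mul_nonneg hl0.le (sub_nonneg.2 i2)]

/-! ### Error bounds and their summation. -/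

/-- Difference of the tail probabilities of the heuristic and of its limit law. -/
noncomputable def tailDiff (n k : ℕ) : ℝ := greedyTail n k - hypoCDF ((n : ℝ) / 2 ^ k)

theorem neg_le_tailDiff (n k : ℕ) : -(2 * (k / 2 ^ k)) ≤ tailDiff n k := by
  have h1 := hypoPartialCDF_le_greedyTail n k
  have h2 := hypoCDF_le_hypoPartialCDF k (((n : ℝ) - k) / 2 ^ k)
  have h3 := hypoCDF_add_le (((n : ℝ) - k) / 2 ^ k) (h := k / 2 ^ k) (by positivity)
  rw [← add_div, sub_add_cancel] at h3
  rw [tailDiff]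
  linarith

/-- The first term is the cost of the dilation, through the Lipschitz bound; the second is the cost
of keeping only `k - j` exponentials. -/
theorem tailDiff_le {j k : ℕ} (hj : j ≠ 0) (hjk : j < k) (n : ℕ) :
    tailDiff n k ≤ 4 * n / (2 ^ j * 2 ^ k) + 2 * 2 ^ j / 2 ^ k := by
  obtain ⟨i, rfl⟩ := Nat.exists_eq_add_of_lt hjk
  rw [add_assoc]
  have h1 := greedyTail_le_hypoPartialCDF hj n (i + 1)
  have h2 := hypoPartialCDF_le_hypoCDF_add (Nat.succ_ne_zero i)
    ((n : ℝ) / (1 - 1 / 2 ^ j) / 2 ^ (j + (i + 1)))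
  have hp : (2 : ℝ) ≤ 2 ^ j := by
    calc (2 : ℝ) = 2 ^ 1 := by simp
      _ ≤ 2 ^ j := pow_le_pow_right₀ one_le_two (by omega)
  have e : (n : ℝ) / (1 - 1 / 2 ^ j) / 2 ^ (j + (i + 1)) =
      n / 2 ^ (j + (i + 1)) + n / ((2 ^ j - 1) * 2 ^ (j + (i + 1))) := by
    have : (2 : ℝ) ^ j - 1 ≠ 0 := by linarith
    field_simp
    ring
  have hd : (0 : ℝ) < 2 ^ j - 1 := by linarith
  have h3 := hypoCDF_add_le ((n : ℝ) / 2 ^ (j + (i + 1)))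
    (h := n / ((2 ^ j - 1) * 2 ^ (j + (i + 1)))) (by positivity)
  rw [← e] at h3
  have h4 : (n : ℝ) / ((2 ^ j - 1) * 2 ^ (j + (i + 1))) ≤
      2 * (n / (2 ^ j * 2 ^ (j + (i + 1)))) := by
    calc (n : ℝ) / ((2 ^ j - 1) * 2 ^ (j + (i + 1))) ≤ n / ((2 ^ j / 2) * 2 ^ (j + (i + 1))) := by
          gcongr
          linarith
      _ = _ := by field_simp
  have h5 : (2 : ℝ) / 2 ^ (i + 1) = 2 * 2 ^ j / 2 ^ (j + (i + 1)) := by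
    rw [pow_add _ j]; field_simp
  have h6 : 4 * (n : ℝ) / (2 ^ j * 2 ^ (j + (i + 1))) =
      4 * (n / (2 ^ j * 2 ^ (j + (i + 1)))) := by ring
  rw [tailDiff, h6, ← h5]
  rw [Nat.succ_eq_add_one] at h2
  linarith

theorem abs_tailDiff_le {j k : ℕ} (hj : j ≠ 0) (hjk : j < k) (n : ℕ) :
    |tailDiff n k| ≤ 2 * (k / 2 ^ k) + 4 * n / (2 ^ j * 2 ^ k) + 2 * 2 ^ j / 2 ^ k := by
  have h1 := neg_le_tailDiff n k
  have h2 := tailDiff_le hj hjk n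
  have h3 : (0 : ℝ) ≤ k / 2 ^ k := by positivity
  have h4 : (0 : ℝ) ≤ 4 * n / (2 ^ j * 2 ^ k) := by positivity
  have h5 : (0 : ℝ) ≤ 2 * 2 ^ j / 2 ^ k := by positivity
  rw [abs_le]
  constructor <;> linarith

/-- For small `k`, with `y = n / 2^k`, both tails are within `12 exp(-y)` of `1`, and `exp(-y) ≤ 2 /
y^2`. -/
theorem abs_tailDiff_le_four_pow {n : ℕ} (hn : n ≠ 0) (k : ℕ) :
    |tailDiff n k| ≤ 24 * 4 ^ k / (n : ℝ) ^ 2 := by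
  set y : ℝ := n / 2 ^ k with hy
  have hn0 : (0 : ℝ) < n := by positivity
  have hy0 : 0 < y := by positivity
  have hk : (k : ℝ) / 2 ^ k ≤ 1 := by
    rw [div_le_one (by positivity)]
    exact_mod_cast Nat.lt_two_pow_self.le
  have hexp : Real.exp (-y) ≤ 2 / y ^ 2 := by
    have := Real.quadratic_le_exp_of_nonneg hy0.le
    rw [Real.exp_neg, inv_le_comm₀ (Real.exp_pos _) (by positivity), inv_div]
    linarith
  have h1 := hypoPartialCDF_le_greedyTail n k
  have h2 := one_sub_hypoPartialCDF_le k (((n : ℝ) - k) / 2 ^ k)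
  have h3 : Real.exp (-(((n : ℝ) - k) / 2 ^ k)) ≤ 3 * Real.exp (-y) := by
    calc Real.exp (-(((n : ℝ) - k) / 2 ^ k)) ≤ Real.exp (1 + -y) := by
          rw [Real.exp_le_exp, hy, sub_div]
          linarith
      _ ≤ 3 * Real.exp (-y) := by
          rw [Real.exp_add]
          gcongr
          linarith [Real.exp_one_lt_d9]
  have h4 := one_sub_hypoCDF_le y
  have h5 := greedyTail_le_one n k
  have h6 := hypoCDF_le_one y
  have h7 : 24 * 4 ^ k / (n : ℝ) ^ 2 = 12 * (2 / y ^ 2) := by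
    rw [hy, div_pow, ← pow_mul, mul_comm k 2, pow_mul]
    norm_num
    field_simp
    norm_num
  rw [h7, tailDiff, abs_le]
  have := Real.exp_pos (-y)
  constructor <;> linarith

theorem summable_abs_tailDiff (n : ℕ) : Summable fun k => |tailDiff n k| := by
  rw [← summable_nat_add_iff (n + 1)]
  refine Summable.of_nonneg_of_le (fun _ => abs_nonneg _) (fun k => ?_)
    (summable_geometric_two.mul_left (2 * (n : ℝ)))
  rw [tailDiff, greedyTail_eq_zero (by omega), zero_sub, abs_neg, abs_of_nonneg (hypoCDF_nonneg _)]
  refine (hypoCDF_le (by positivity)).trans ?_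
  rw [mul_assoc, one_div_pow, mul_one_div]
  gcongr
  · exact one_le_two
  · omega

/-- With `A = 2^a` and `n` between `A^6` and `64 A^6`, the cut is at `2^k = A^5`. Below it the sum
of `4^k / n^2` is of order `A^10 / A^12`; above it `2^j = A^3` balances `n / (2^j 2^k)` with `2^j /
2^k`. -/
theorem tsum_abs_tailDiff_le {n a : ℕ} (ha : a ≠ 0) (h1 : 2 ^ (6 * a) ≤ n)
    (h2 : n ≤ 2 ^ (6 * a + 6)) : ∑' k, |tailDiff n k| ≤ 1096 / (2 ^ a) ^ 2 := by
  set A : ℝ := 2 ^ a with hA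
  have hA1 : 1 ≤ A := one_le_pow₀ one_le_two
  have hA0 : 0 < A := by positivity
  have hAa : (a : ℝ) ≤ A := by
    rw [hA]
    exact_mod_cast Nat.lt_two_pow_self.le
  have g1 : A ^ 6 ≤ n := by
    rw [hA, ← pow_mul, mul_comm a 6]
    exact_mod_cast h1
  have g2 : (n : ℝ) ≤ 64 * A ^ 6 := by
    have : (n : ℝ) ≤ 2 ^ (6 * a + 6) := by exact_mod_cast h2
    rw [pow_add, mul_comm 6 a, pow_mul] at this
    linarith
  have hn : n ≠ 0 := by
    rintro rfl
    simp at h1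
  have hlow : ∑ k ∈ Finset.range (5 * a), |tailDiff n k| ≤ 8 / A ^ 2 := by
    calc ∑ k ∈ Finset.range (5 * a), |tailDiff n k|
        ≤ ∑ k ∈ Finset.range (5 * a), 24 / (n : ℝ) ^ 2 * 4 ^ k := by
          refine Finset.sum_le_sum fun k _ => (abs_tailDiff_le_four_pow hn k).trans (le_of_eq ?_)
          ring
      _ = 24 / (n : ℝ) ^ 2 * ((4 ^ (5 * a) - 1) / 3) := by
          rw [← Finset.mul_sum, geom_sum_eq (by norm_num)]
          norm_num
      _ ≤ 24 / (A ^ 6) ^ 2 * (A ^ 10 / 3) := by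
          have e : (4 : ℝ) ^ (5 * a) = A ^ 10 := by
            rw [hA, ← pow_mul, show (4 : ℝ) = 2 ^ 2 by norm_num, ← pow_mul]
            ring_nf
          rw [e]
          have : (1 : ℝ) ≤ A ^ 10 := one_le_pow₀ hA1
          gcongr
          · linarith
      _ = 8 / A ^ 2 := by
          field_simp
          norm_num
  have hhigh : ∑' i, |tailDiff n (i + 5 * a)| ≤ 1088 / A ^ 2 := by
    have hterm : ∀ i : ℕ, |tailDiff n (i + 5 * a)| ≤ 272 / A ^ 2 * (3 / 4) ^ i := fun i => by
      -- Bernoulli's inequality absorbs the linear growth in `i`; against `2^i` there remains the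
      -- ratio `3/4`.
      have hi : (1 : ℝ) + i / 2 ≤ (3 / 2) ^ i := by
        have := one_add_mul_le_pow (show (-2 : ℝ) ≤ 1 / 2 by norm_num) i
        norm_num at this ⊢
        linarith
      have hA3 : A ≤ A ^ 3 := le_self_pow₀ hA1 (by norm_num)
      have hA31 : 1 ≤ A ^ 3 := one_le_pow₀ hA1
      have hp : (2 : ℝ) ^ (i + 5 * a) = A ^ 5 * 2 ^ i := by
        rw [hA, pow_add, ← pow_mul, mul_comm a 5, mul_comm]
      have hj : (2 : ℝ) ^ (3 * a) = A ^ 3 := by rw [hA, ← pow_mul, mul_comm a 3]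
      calc |tailDiff n (i + 5 * a)|
          ≤ 2 * ((i + 5 * a : ℕ) / 2 ^ (i + 5 * a)) +
            4 * n / (2 ^ (3 * a) * 2 ^ (i + 5 * a)) + 2 * 2 ^ (3 * a) / 2 ^ (i + 5 * a) :=
            abs_tailDiff_le (by omega) (by omega) n
        _ ≤ 2 * ((i + 5 * a : ℕ) / (A ^ 5 * 2 ^ i)) +
            4 * (64 * A ^ 6) / (A ^ 3 * (A ^ 5 * 2 ^ i)) + 2 * A ^ 3 / (A ^ 5 * 2 ^ i) := by
            rw [hp, hj]
            gcongr
        _ = (2 * (i + 5 * a) + 258 * A ^ 3) / (A ^ 5 * 2 ^ i) := by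
            push_cast
            field_simp
            ring
        _ ≤ (272 * (3 / 2) ^ i * A ^ 3) / (A ^ 5 * 2 ^ i) := by
            gcongr
            have hi0 : (0 : ℝ) ≤ i := Nat.cast_nonneg i
            nlinarith [mul_le_mul_of_nonneg_right hi (show 0 ≤ A ^ 3 by positivity),
              mul_le_mul_of_nonneg_left hA31 hi0]
        _ = 272 / A ^ 2 * (3 / 4) ^ i := by
            rw [show (3 / 4 : ℝ) = 3 / 2 / 2 by norm_num, div_pow (3 / 2 : ℝ) 2]
            field_simp
    have hs : Summable fun i : ℕ => 272 / A ^ 2 * (3 / 4 : ℝ) ^ i :=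
      (summable_geometric_of_lt_one (by norm_num) (by norm_num)).mul_left _
    refine (((summable_nat_add_iff (5 * a)).2 (summable_abs_tailDiff n)).tsum_le_tsum
      hterm hs).trans (le_of_eq ?_)
    rw [tsum_mul_left, tsum_geometric_of_lt_one (by norm_num) (by norm_num)]
    field_simp
    norm_num
  rw [← (summable_abs_tailDiff n).sum_add_tsum_nat_add (5 * a)]
  calc _ ≤ 8 / A ^ 2 + 1088 / A ^ 2 := add_le_add hlow hhigh
    _ = 1096 / A ^ 2 := by ring

theorem abs_pGreedy_sub_qHypo_le (n k : ℕ) :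
    |pGreedy n k - qHypo n k| ≤ |tailDiff n k| + |tailDiff n (k + 1)| := by
  rw [pGreedy_eq_sub, qHypo_eq_sub]
  calc _ = |tailDiff n k - tailDiff n (k + 1)| := by
        rw [tailDiff, tailDiff]
        ring_nf
    _ ≤ _ := abs_sub _ _

theorem summable_abs_pGreedy_sub_qHypo (n : ℕ) :
    Summable fun k : ℕ => |pGreedy n k - qHypo n k| :=
  Summable.of_nonneg_of_le (fun _ => abs_nonneg _) (abs_pGreedy_sub_qHypo_le n)
    ((summable_abs_tailDiff n).add ((summable_nat_add_iff 1).2 (summable_abs_tailDiff n)))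

theorem tsum_abs_pGreedy_sub_qHypo_le (n : ℕ) :
    ∑' k : ℕ, |pGreedy n k - qHypo n k| ≤ 2 * ∑' k, |tailDiff n k| := by
  have hs := summable_abs_tailDiff n
  have hs1 := (summable_nat_add_iff 1).2 hs
  have h := hs.sum_add_tsum_nat_add 1
  have h0 : 0 ≤ ∑ k ∈ Finset.range 1, |tailDiff n k| :=
    Finset.sum_nonneg fun _ _ => abs_nonneg _
  refine ((summable_abs_pGreedy_sub_qHypo n).tsum_le_tsum (abs_pGreedy_sub_qHypo_le n)
    (hs.add hs1)).trans ?_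
  rw [hs.tsum_add hs1]
  linarith

theorem tsum_abs_pGreedy_sub_qHypo_le_rpow {n : ℕ} (hn : 64 ≤ n) :
    ∑' k : ℕ, |pGreedy n k - qHypo n k| ≤ 8768 / (n : ℝ) ^ (1 / 3 : ℝ) := by
  -- Rounding down costs at most the factor `64` in `n`, hence `4` in its cube root; `n ≥ 64` gives
  -- `a ≠ 0`.
  set a := Nat.log 2 n / 6 with ha
  have hlog : 6 ≤ Nat.log 2 n := by
    exact Nat.le_log_of_pow_le one_lt_two (by simpa using hn)
  have h1 : 2 ^ (6 * a) ≤ n :=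
    (Nat.pow_le_pow_right two_pos (by omega)).trans (Nat.pow_log_le_self 2 (by omega))
  have h2 : n ≤ 2 ^ (6 * a + 6) :=
    (Nat.lt_pow_succ_log_self one_lt_two n).le.trans (Nat.pow_le_pow_right two_pos (by omega))
  have h3 := tsum_abs_tailDiff_le (by omega) h1 h2
  have hn0 : (0 : ℝ) < n := by
    have : 0 < n := by omega
    exact_mod_cast this
  have h4 : (n : ℝ) ^ (1 / 3 : ℝ) ≤ 4 * (2 ^ a) ^ 2 := by
    calc (n : ℝ) ^ (1 / 3 : ℝ) ≤ ((4 * (2 ^ a) ^ 2) ^ 3 : ℝ) ^ (1 / 3 : ℝ) := by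
          refine Real.rpow_le_rpow hn0.le ?_ (by norm_num)
          have : (n : ℝ) ≤ 2 ^ (6 * a + 6) := by exact_mod_cast h2
          refine this.trans (le_of_eq ?_)
          rw [mul_pow, ← pow_mul, ← pow_mul, pow_add, mul_comm ((2 : ℝ) ^ (6 * a))]
          congr 1
          · norm_num
          · congr 1; ring
      _ = 4 * (2 ^ a) ^ 2 := by
          have := Real.pow_rpow_inv_natCast (show (0 : ℝ) ≤ 4 * (2 ^ a) ^ 2 by positivity)
            (show 3 ≠ 0 by norm_num)
          simpa using this
  have h5 : 1096 / ((2 : ℝ) ^ a) ^ 2 ≤ 4384 / (n : ℝ) ^ (1 / 3 : ℝ) := by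
    rw [div_le_div_iff₀ (by positivity) (by positivity)]
    linarith
  have h6 := tsum_abs_pGreedy_sub_qHypo_le n
  calc _ ≤ 2 * (4384 / (n : ℝ) ^ (1 / 3 : ℝ)) := by linarith
    _ = _ := by ring

theorem theorem1 :
    (∀ n : ℕ, Summable fun k : ℕ => |pGreedy n k - qHypo n k|) ∧
    Tendsto (fun n : ℕ => ∑' k : ℕ, |pGreedy n k - qHypo n k|) atTop (𝓝 0) ∧
    (fun n : ℕ => ∑' k : ℕ, |pGreedy n k - qHypo n k|) =O[atTop]
      (fun n : ℕ => √(Real.log (n : ℝ)) / (n : ℝ) ^ (1 / 3 : ℝ)) := by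
  refine ⟨summable_abs_pGreedy_sub_qHypo, ?_, ?_⟩
  · refine squeeze_zero' (Eventually.of_forall fun n => tsum_nonneg fun _ => abs_nonneg _)
      ((eventually_ge_atTop 64).mono fun n hn => tsum_abs_pGreedy_sub_qHypo_le_rpow hn) ?_
    exact tendsto_const_nhds.div_atTop
      ((tendsto_rpow_atTop (by norm_num)).comp tendsto_natCast_atTop_atTop)
  · refine IsBigO.of_bound 8768 ((eventually_ge_atTop 64).mono fun n hn => ?_)
    have hn' : (64 : ℝ) ≤ n := by exact_mod_cast hn
    rw [Real.norm_of_nonneg (tsum_nonneg fun _ => abs_nonneg _),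
      Real.norm_of_nonneg (by positivity)]
    refine (tsum_abs_pGreedy_sub_qHypo_le_rpow hn).trans ?_
    -- The bound already holds without the logarithm, so it suffices that this factor is at least
    -- `1`.
    have hlog : 1 ≤ √(Real.log n) := by
      rw [Real.one_le_sqrt, Real.le_log_iff_exp_le (by linarith)]
      linarith [Real.exp_one_lt_d9]
    rw [mul_div_assoc']
    gcongr
    linarith
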